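/- Let $R$ be a commutative noetherian ring and let $C$ be a semidualizing $R$-module, i.e. a finitely generated $R$-module such that the homothety map $R\to\operatorname{Hom}_R(C,C)$ is an isomorphism and $\operatorname{Ext}^i_R(C,C)=0$ for all $i\ge 1$. Let $\mathcal P_C$ (resp. $\mathcal F_C$) be the class of $R$-modules isomorphic to $P\otimes_R C$ with $P$ projective (resp. to $F\otimes_R C$ with $F$ flat). For $\mathcal X\in\{\mathcal P_C,\mathcal F_C\}$, a proper $\mathcal X$-resolution of an $R$-module $M$ is a complex $X=(\cdots\to X_1\to X_0\to 0)$ of modules in $\mathcal X$ together with a map $X_0\to M$ such that $X^+=(\cdots\to X_1\to X_0\to M\to 0)$ is a complex and $\operatorname{Hom}_R(Y,X^+)$ is exact for every $Y\in\mathcal X$. Given a proper $\mathcal P_C$-resolution $Q$ and a proper $\mathcal F_C$-resolution $G$ of $M$, put $$\operatorname{Tor}^{\mathcal P_C\mathcal M}_i(M,N)=\operatorname{H}_i(Q\otimes_R N),\qquad \operatorname{Tor}^{\mathcal F_C\mathcal M}_i(M,N)=\operatorname{H}_i(G\otimes_R N).$$ These are independent of the choice of the resolutions up to canonical isomorphism,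 and functorial in $M$ and $N$ via lifts of $f\colon M\to M'$ to chain maps of the resolutions. Let $\varrho_i\colon\operatorname{Tor}^{\mathcal P_C\mathcal M}_i(M,N)\to\operatorname{Tor}^{\mathcal F_C\mathcal M}_i(M,N)$ be the map induced by a chain map $Q\to G$ lifting $\operatorname{id}_M$ (such a chain map exists and is unique up to homotopy). Then for every $i\ge 0$, all $R$-modules $M$ and $N$, and all such resolutions $Q$ and $G$, there are isomorphisms, natural in $M$ and $N$, $$\operatorname{Tor}^{\mathcal P_C\mathcal M}_i(M,N)\xrightarrow{\ \cong\ }\operatorname{Tor}^R_i(\operatorname{Hom}_R(C,M),C\otimes_R N)\xrightarrow{\ \cong\ }\operatorname{Tor}^{\mathcal F_C\mathcal M}_i(M,N),$$ and $\varrho_i$ is an isomorphism for all $M$ and $N$. -/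

import Mathlib

open CategoryTheory MonoidalCategory Opposite

universe u

noncomputable section

namespace RelativeTor

variable {R : Type u} [CommRing R]

/-- A finitely generated module `C` is semidualizing if the homothety map `R → Hom(C, C)` is an
isomorphism and `Ext^i(C, C) = 0` for all `i ≥ 1`. -/
structure IsSemidualizing (C : ModuleCat.{u} R) : Prop where
  finite : Module.Finite R C
  homothety_bijective : Function.Bijective (LinearMap.lsmul R C)
  ext_eq_zero : ∀ i : ℕ, 1 ≤ i → Subsingleton (Abelian.Ext.{u} C C i)

/-- The class `P_C` of `C`-projective modules: those isomorphic to `P ⊗ C` with `P` projective. -/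
def cProjective (C : ModuleCat.{u} R) : ObjectProperty (ModuleCat.{u} R) := fun M =>
  ∃ P : ModuleCat.{u} R, Module.Projective R P ∧ Nonempty (M ≅ P ⊗ C)

/-- The class `F_C` of `C`-flat modules: those isomorphic to `F ⊗ C` with `F` flat. -/
def cFlat (C : ModuleCat.{u} R) : ObjectProperty (ModuleCat.{u} R) := fun M =>
  ∃ F : ModuleCat.{u} R, Module.Flat R F ∧ Nonempty (M ≅ F ⊗ C)

theorem cProjective_le_cFlat (C : ModuleCat.{u} R) : cProjective C ≤ cFlat C := by
  rintro M ⟨P, hP, e⟩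
  exact ⟨P, inferInstance, e⟩

/-- The complex `Hom_R(Y, K)` of `R`-modules, for an `R`-module `Y` and an `R`-complex `K`. -/
abbrev homComplex (Y : ModuleCat.{u} R) (K : ChainComplex (ModuleCat.{u} R) ℕ) :
    ChainComplex (ModuleCat.{u} R) ℕ :=
  (((linearCoyoneda R (ModuleCat.{u} R)).obj (op Y)).mapHomologicalComplex _).obj K

/-- A proper `X`-resolution of `M`: a complex `⋯ → X₁ → X₀ → 0` of modules in `X` with an
augmentation `X₀ → M`, such that the augmented complex `X⁺ = (⋯ → X₁ → X₀ → M → 0)` satisfies: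
`Hom(Y, X⁺)` is exact for every `Y` in `X`. (`X⁺` itself need not be exact.) -/
structure ProperResolution (X : ObjectProperty (ModuleCat.{u} R)) (M : ModuleCat.{u} R) where
  complex : ChainComplex (ModuleCat.{u} R) ℕ
  mem : ∀ n, X (complex.X n)
  π : complex.X 0 ⟶ M
  d_comp_π : complex.d 1 0 ≫ π = 0
  proper : ∀ Y, X Y → (homComplex Y (complex.augment π d_comp_π)).Acyclic

namespace ProperResolution

variable {X X' X'' : ObjectProperty (ModuleCat.{u} R)} {M M' M'' : ModuleCat.{u} R}

theorem lift_zero (Q : ProperResolution X M) {Y : ModuleCat.{u} R} (hY : X Y) (g : Y ⟶ M) :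
    ∃ h : Y ⟶ Q.complex.X 0, h ≫ Q.π = g := by
  have h := Q.proper Y hY 0
  rw [HomologicalComplex.exactAt_iff' _ 1 0 0 (by simp) (by simp),
    ShortComplex.moduleCat_exact_iff] at h
  obtain ⟨y, hy⟩ := h g (by
    change g ≫ (Q.complex.augment Q.π Q.d_comp_π).d 0 0 = 0
    rw [HomologicalComplex.shape _ _ _ (by simp)]; exact Limits.comp_zero)
  exact ⟨y, hy⟩

theorem lift_one (Q : ProperResolution X M) {Y : ModuleCat.{u} R} (hY : X Y)
    (g : Y ⟶ Q.complex.X 0) (hg : g ≫ Q.π = 0) :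
    ∃ h : Y ⟶ Q.complex.X 1, h ≫ Q.complex.d 1 0 = g := by
  have h := Q.proper Y hY 1
  rw [HomologicalComplex.exactAt_iff' _ 2 1 0 (by simp) (by simp),
    ShortComplex.moduleCat_exact_iff] at h
  obtain ⟨y, hy⟩ := h g hg
  exact ⟨y, hy⟩

theorem lift_succ (Q : ProperResolution X M) {Y : ModuleCat.{u} R} (hY : X Y) (n : ℕ)
    (g : Y ⟶ Q.complex.X (n + 1)) (hg : g ≫ Q.complex.d (n + 1) n = 0) :
    ∃ h : Y ⟶ Q.complex.X (n + 2), h ≫ Q.complex.d (n + 2) (n + 1) = g := by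
  have h := Q.proper Y hY (n + 2)
  rw [HomologicalComplex.exactAt_iff' _ (n + 3) (n + 2) (n + 1) (by simp) (by simp),
    ShortComplex.moduleCat_exact_iff] at h
  obtain ⟨y, hy⟩ := h g hg
  exact ⟨y, hy⟩

/-- A chain map `Q → Q'` is a lift of `f : M ⟶ M'` if, with `f` in degree `-1`, it is a chain map
`Q⁺ → Q'⁺` of augmented complexes. -/
def IsLift (Q : ProperResolution X M) (Q' : ProperResolution X' M') (f : M ⟶ M')
    (φ : Q.complex ⟶ Q'.complex) : Prop :=
  φ.f 0 ≫ Q'.π = Q.π ≫ f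

theorem exists_isLift (h : X ≤ X') (Q : ProperResolution X M) (Q' : ProperResolution X' M')
    (f : M ⟶ M') : ∃ φ : Q.complex ⟶ Q'.complex, IsLift Q Q' f φ := by
  choose zero hzero using Q'.lift_zero (h _ (Q.mem 0)) (Q.π ≫ f)
  choose one hone using Q'.lift_one (h _ (Q.mem 1)) (Q.complex.d 1 0 ≫ zero)
    (by rw [Category.assoc, hzero, ← Category.assoc, Q.d_comp_π, Limits.zero_comp])
  have succ : ∀ (n : ℕ) (g : Q.complex.X n ⟶ Q'.complex.X n)
      (g' : Q.complex.X (n + 1) ⟶ Q'.complex.X (n + 1))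
      (_ : g' ≫ Q'.complex.d (n + 1) n = Q.complex.d (n + 1) n ≫ g),
      ∃ g'' : Q.complex.X (n + 2) ⟶ Q'.complex.X (n + 2),
        g'' ≫ Q'.complex.d (n + 2) (n + 1) = Q.complex.d (n + 2) (n + 1) ≫ g' := by
    intro n g g' w
    exact Q'.lift_succ (h _ (Q.mem _)) n _ (by simp [w])
  choose s hs using succ
  exact ⟨ChainComplex.mkHom _ _ zero one hone fun n p => ⟨s n p.1 p.2.1 p.2.2, hs n p.1 p.2.1 p.2.2⟩,
    hzero⟩

theorem IsLift.homotopy (h : X ≤ X') {Q : ProperResolution X M} {Q' : ProperResolution X' M'}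
    {f : M ⟶ M'} {φ ψ : Q.complex ⟶ Q'.complex} (hφ : IsLift Q Q' f φ) (hψ : IsLift Q Q' f ψ) :
    Nonempty (Homotopy φ ψ) := by
  have h0 : (φ - ψ).f 0 ≫ Q'.π = 0 := by
    rw [HomologicalComplex.sub_f_apply, Preadditive.sub_comp, hφ, hψ, sub_self]
  choose zero hzero using Q'.lift_one (h _ (Q.mem 0)) _ h0
  choose one hone using Q'.lift_succ (h _ (Q.mem 1)) 0
    ((φ - ψ).f 1 - Q.complex.d 1 0 ≫ zero) (by
      rw [Preadditive.sub_comp, Category.assoc, hzero, (φ - ψ).comm, sub_self])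
  have succ : ∀ (n : ℕ) (g : Q.complex.X n ⟶ Q'.complex.X (n + 1))
      (g' : Q.complex.X (n + 1) ⟶ Q'.complex.X (n + 2))
      (_ : (φ - ψ).f (n + 1) = Q.complex.d (n + 1) n ≫ g + g' ≫ Q'.complex.d (n + 2) (n + 1)),
      ∃ g'' : Q.complex.X (n + 2) ⟶ Q'.complex.X (n + 3),
        (φ - ψ).f (n + 2) =
          Q.complex.d (n + 2) (n + 1) ≫ g' + g'' ≫ Q'.complex.d (n + 3) (n + 2) := by
    intro n g g' w
    obtain ⟨g'', hg⟩ := Q'.lift_succ (h _ (Q.mem _)) (n + 1)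
      ((φ - ψ).f (n + 2) - Q.complex.d (n + 2) (n + 1) ≫ g') (by
        rw [Preadditive.sub_comp, (φ - ψ).comm, w]; simp)
    exact ⟨g'', by rw [hg]; abel⟩
  choose s hs using succ
  exact ⟨(Homotopy.equivSubZero).symm (Homotopy.mkInductive (φ - ψ) zero hzero.symm one
    (by rw [hone]; abel) fun n p => ⟨s n p.1 p.2.1 p.2.2, hs n p.1 p.2.1 p.2.2⟩)⟩

end ProperResolution

/-- The map of complexes `φ ⊗ g : K ⊗ N ⟶ K' ⊗ N'` induced by a chain map `φ : K ⟶ K'` and a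
module homomorphism `g : N ⟶ N'`. -/
def tensorComplexMap {K K' : ChainComplex (ModuleCat.{u} R) ℕ} {N N' : ModuleCat.{u} R}
    (φ : K ⟶ K') (g : N ⟶ N') :
    ((tensorRight N).mapHomologicalComplex _).obj K ⟶
      ((tensorRight N').mapHomologicalComplex _).obj K' where
  f n := φ.f n ⊗ₘ g
  comm' i j _ := by
    change (φ.f i ⊗ₘ g) ≫ (K'.d i j ▷ N') = (K.d i j ▷ N) ≫ (φ.f j ⊗ₘ g)
    simp only [MonoidalCategory.tensorHom_def', Category.assoc,
      ← MonoidalCategory.comp_whiskerRight, φ.comm]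
    simp only [MonoidalCategory.comp_whiskerRight, MonoidalCategory.whisker_exchange_assoc]

theorem tensorComplexMap_id (K : ChainComplex (ModuleCat.{u} R) ℕ) (N : ModuleCat.{u} R) :
    tensorComplexMap (𝟙 K) (𝟙 N) = 𝟙 _ := by
  ext n : 1
  exact MonoidalCategory.id_tensorHom_id (K.X n) N

theorem tensorComplexMap_comp {K K' K'' : ChainComplex (ModuleCat.{u} R) ℕ}
    {N N' N'' : ModuleCat.{u} R} (φ : K ⟶ K') (φ' : K' ⟶ K'') (g : N ⟶ N') (g' : N' ⟶ N'') :
    tensorComplexMap (φ ≫ φ') (g ≫ g') = tensorComplexMap φ g ≫ tensorComplexMap φ' g' := by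
  ext n : 1
  exact (MonoidalCategory.tensorHom_comp_tensorHom (φ.f n) g (φ'.f n) g').symm

theorem tensorComplexMap_eq {K K' : ChainComplex (ModuleCat.{u} R) ℕ} {N N' : ModuleCat.{u} R}
    (φ : K ⟶ K') (g : N ⟶ N') : tensorComplexMap φ g =
      ((tensorRight N).mapHomologicalComplex _).map φ ≫ tensorComplexMap (𝟙 _) g := by
  ext n : 1
  change φ.f n ⊗ₘ g = (φ.f n ▷ N) ≫ (𝟙 _ ⊗ₘ g)
  rw [MonoidalCategory.tensorHom_def, MonoidalCategory.id_tensorHom]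

section

variable {X X' X'' : ObjectProperty (ModuleCat.{u} R)} {M M' M'' N N' N'' : ModuleCat.{u} R}

/-- The relative Tor module `H_i(Q ⊗ N)`, where `Q` is a proper `X`-resolution of `M`. For
`X = P_C` this is `Tor^{P_C M}_i(M, N)`, for `X = F_C` it is `Tor^{F_C M}_i(M, N)`. -/
abbrev relTor (Q : ProperResolution X M) (N : ModuleCat.{u} R) (i : ℕ) : ModuleCat.{u} R :=
  (((tensorRight N).mapHomologicalComplex _).obj Q.complex).homology i

/-- The map on relative Tor induced by `f : M ⟶ M'` and `g : N ⟶ N'`: the map in homology of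
`φ ⊗ g`, for a lift `φ : Q ⟶ Q'` of `f`. The class `X` may be smaller than `X'`.
By `relTorMap_eq` the choice of the lift is irrelevant. -/
def relTorMap (h : X ≤ X') (Q : ProperResolution X M) (Q' : ProperResolution X' M')
    (f : M ⟶ M') (g : N ⟶ N') (i : ℕ) : relTor Q N i ⟶ relTor Q' N' i :=
  HomologicalComplex.homologyMap
    (tensorComplexMap (ProperResolution.exists_isLift h Q Q' f).choose g) i

theorem relTorMap_eq (h : X ≤ X') (Q : ProperResolution X M) (Q' : ProperResolution X' M')
    (f : M ⟶ M') (g : N ⟶ N') (i : ℕ) (φ : Q.complex ⟶ Q'.complex)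
    (hφ : ProperResolution.IsLift Q Q' f φ) :
    relTorMap h Q Q' f g i = HomologicalComplex.homologyMap (tensorComplexMap φ g) i := by
  obtain ⟨H⟩ := ProperResolution.IsLift.homotopy h
    (ProperResolution.exists_isLift h Q Q' f).choose_spec hφ
  rw [relTorMap, tensorComplexMap_eq, tensorComplexMap_eq φ, HomologicalComplex.homologyMap_comp,
    HomologicalComplex.homologyMap_comp, ((tensorRight N).mapHomotopy H).homologyMap_eq]

theorem relTorMap_id (Q : ProperResolution X M) (N : ModuleCat.{u} R) (i : ℕ) :
    relTorMap le_rfl Q Q (𝟙 M) (𝟙 N) i = 𝟙 (relTor Q N i) := by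
  rw [relTorMap_eq le_rfl Q Q (𝟙 M) (𝟙 N) i (𝟙 _) (by simp [ProperResolution.IsLift])]
  rw [tensorComplexMap_id, HomologicalComplex.homologyMap_id]

theorem relTorMap_comp (h : X ≤ X') (h' : X' ≤ X'') (Q : ProperResolution X M)
    (Q' : ProperResolution X' M') (Q'' : ProperResolution X'' M'')
    (f : M ⟶ M') (f' : M' ⟶ M'') (g : N ⟶ N') (g' : N' ⟶ N'') (i : ℕ) :
    relTorMap h Q Q' f g i ≫ relTorMap h' Q' Q'' f' g' i =
      relTorMap (h.trans h') Q Q'' (f ≫ f') (g ≫ g') i := by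
  obtain ⟨φ, hφ⟩ := ProperResolution.exists_isLift h Q Q' f
  obtain ⟨ψ, hψ⟩ := ProperResolution.exists_isLift h' Q' Q'' f'
  rw [relTorMap_eq h Q Q' f g i φ hφ, relTorMap_eq h' Q' Q'' f' g' i ψ hψ,
    relTorMap_eq (h.trans h') Q Q'' (f ≫ f') (g ≫ g') i (φ ≫ ψ) (by
      unfold ProperResolution.IsLift at *
      rw [HomologicalComplex.comp_f, Category.assoc, hψ, ← Category.assoc, hφ, Category.assoc]),
    tensorComplexMap_comp, HomologicalComplex.homologyMap_comp]

/-- The comparison map `ϱ_i : Tor^{P_C M}_i(M, N) ⟶ Tor^{F_C M}_i(M, N)`, induced by a lift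
`Q ⟶ G` of the identity of `M`. -/
def rho (C : ModuleCat.{u} R) (Q : ProperResolution (cProjective C) M)
    (G : ProperResolution (cFlat C) M) (N : ModuleCat.{u} R) (i : ℕ) :
    relTor Q N i ⟶ relTor G N i :=
  relTorMap (cProjective_le_cFlat C) Q G (𝟙 M) (𝟙 N) i

theorem rho_naturality (C : ModuleCat.{u} R)
    (Q : ProperResolution (cProjective C) M) (G : ProperResolution (cFlat C) M)
    (Q' : ProperResolution (cProjective C) M') (G' : ProperResolution (cFlat C) M')
    (f : M ⟶ M') (g : N ⟶ N') (i : ℕ) :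
    relTorMap le_rfl Q Q' f g i ≫ rho C Q' G' N' i =
      rho C Q G N i ≫ relTorMap le_rfl G G' f g i := by
  simp only [rho, relTorMap_comp, Category.id_comp, Category.comp_id]

/-- `Tor_i(Hom(C, M), C ⊗ N)`, where the absolute Tor is computed from a projective resolution of
the first argument. -/
def torHomTensor (C M N : ModuleCat.{u} R) (i : ℕ) : ModuleCat.{u} R :=
  ((Tor' (ModuleCat.{u} R) i).obj ((ihom C).obj M)).obj (C ⊗ N)

/-- The functoriality of `Tor_i(Hom(C, M), C ⊗ N)` in `M` and `N`. -/
def torHomTensorMap (C : ModuleCat.{u} R) (f : M ⟶ M') (g : N ⟶ N') (i : ℕ) :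
    torHomTensor C M N i ⟶ torHomTensor C M' N' i :=
  ((Tor' (ModuleCat.{u} R) i).map ((ihom C).map f)).app (C ⊗ N) ≫
    ((Tor' (ModuleCat.{u} R) i).obj ((ihom C).obj M')).map (C ◁ g)

end

end RelativeTor

end

/-! The functors `- ⊗ C` and `Hom(C, -)` are adjoint, and for flat `F` the unit `F → Hom(C, F ⊗ C)`
is an isomorphism (`bijective_mk_of_flat`); hence the counit is an isomorphism on C-flat modules.
Flat modules and C-flat modules thus correspond, and relative Tor becomes absolute Tor.

If `P` is a projective resolution of `Hom(C, M)`, then `P ⊗ C` is a proper `P_C`-resolution of `M`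
(`tensorResolution`), and `(P ⊗ C) ⊗ N ≅ P ⊗ (C ⊗ N)` identifies its relative Tor with `Tor(Hom(C,
M), C ⊗ N)`.

Any two resolutions `Q`, `G` are compared by testing properness at the single module `C`: `Hom(C,
Q)` and `Hom(C, G)` both resolve `Hom(C, M)`, so a lift `φ` of the identity gives a
quasi-isomorphism `Hom(C, φ)` between complexes of flat modules. It survives tensoring with `C ⊗ N`
(`quasiIso_map_tensorRight_of_flat`), and `Hom(C, K) ⊗ (C ⊗ N) ≅ K ⊗ N` for C-flat `K` turns the
result into `φ ⊗ N`. Naturality follows from functoriality of `relTorMap`. -/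

noncomputable section

namespace RelativeTor

variable {R : Type u} [CommRing R]

/-! ### Unit and counit of the adjunction on flat and C-flat modules -/

/-- If `F` is flat and `C` is finitely generated with `R ≅ Hom(C, C)`, then `F ≅ Hom(C, F ⊗ C)`. -/
theorem bijective_mk_of_flat [IsNoetherianRing R] (F C : Type u) [AddCommGroup F] [Module R F]
    [AddCommGroup C] [Module R C] [Module.Flat R F] [Module.Finite R C]
    (hC : Function.Bijective (LinearMap.lsmul R C)) :
    Function.Bijective (TensorProduct.mk R F C) := by
  -- From a finite presentation `R^m → R^n → C → 0`, applying `Hom(-, C)` gives `0 → R → C^n → C^m`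
  -- exact, with maps `a`, `b`. Tensoring with the flat `F` identifies `F` with the kernel of `(F ⊗
  -- C)^n → (F ⊗ C)^m`, which is `Hom(C, F ⊗ C)`.
  obtain ⟨n, p, hp⟩ := Module.Finite.exists_fin' R C
  obtain ⟨m, q, hq⟩ := Module.Finite.exists_fin' R (LinearMap.ker p)
  let a : R →ₗ[R] (Fin n → C) :=
    LinearMap.pi fun i => LinearMap.toSpanSingleton R C (p (Pi.single i 1))
  let b : (Fin n → C) →ₗ[R] (Fin m → C) :=
    LinearMap.pi fun j => ∑ i, (q (Pi.single j 1) : Fin n → R) i • LinearMap.proj i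
  have hb : ∀ d j, b d j = ∑ i, (q (Pi.single j 1) : Fin n → R) i • d i := by
    intro d j; simp [b]
  have hlin : ∀ (W : Type u) [AddCommGroup W] [Module R W] (k : (Fin n → R) →ₗ[R] W) x,
      k x = ∑ i, x i • k (Pi.single i 1) := by
    intro W _ _ k x
    conv_lhs => rw [pi_eq_sum_univ' x]
    simp only [map_sum, map_smul]
  have ext_gen : ∀ (W : Type u) [AddCommGroup W] [Module R W] (h h' : C →ₗ[R] W),
      (∀ i, h (p (Pi.single i 1)) = h' (p (Pi.single i 1))) → h = h' := by
    intro W _ _ h h' w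
    have : h ∘ₗ p = h' ∘ₗ p := by
      ext i
      exact w i
    ext c
    obtain ⟨x, rfl⟩ := hp c
    exact LinearMap.congr_fun this x
  have hrel : ∀ j, ∑ i, (q (Pi.single j 1) : Fin n → R) i • p (Pi.single i 1) = 0 := by
    intro j
    rw [← hlin _ p]
    exact (q (Pi.single j 1)).2
  have a_inj : Function.Injective a := by
    intro r s hrs
    exact hC.1 (ext_gen _ _ _ fun i => congrFun hrs i)
  have ab : Function.Exact a b := by
    intro d
    constructor
    · intro hd
      -- If `b d = 0`, the tuple `d` respects the relations of `C`, so it defines an endomorphism of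
      -- `C`, which is a homothety.
      let P : (Fin n → R) →ₗ[R] C := Fintype.linearCombination R d
      have hP : ∀ x, P x = ∑ i, x i • d i := fun x => Fintype.linearCombination_apply R d x
      have hker : LinearMap.ker p ≤ LinearMap.ker P := by
        intro x hx
        obtain ⟨y, hy⟩ := hq ⟨x, hx⟩
        have key : (P ∘ₗ (LinearMap.ker p).subtype ∘ₗ q) = 0 := by
          ext j
          have := congrFun hd j
          rw [hb] at this
          simpa [hP] using this
        have := LinearMap.congr_fun key y
        simpa [hy] using this
      let φ : C →ₗ[R] C := (LinearMap.ker p).liftQ P hker ∘ₗ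
        (p.quotKerEquivOfSurjective hp).symm.toLinearMap
      have hφ : ∀ x, φ (p x) = P x := by
        intro x
        have : (p.quotKerEquivOfSurjective hp).symm (p x) = (LinearMap.ker p).mkQ x := by
          rw [LinearEquiv.symm_apply_eq]; rfl
        simp [φ, this]
      obtain ⟨r, hr⟩ := hC.2 φ
      refine ⟨r, funext fun i => ?_⟩
      have := hφ (Pi.single i 1)
      rw [← hr] at this
      change r • p (Pi.single i 1) = _
      rw [LinearMap.lsmul_apply] at this
      rw [this, hP]
      simp [Pi.single_apply]
    · rintro ⟨r, rfl⟩
      ext j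
      rw [hb]
      change ∑ i, _ • (r • p (Pi.single i 1)) = 0
      simp_rw [smul_comm _ r]
      rw [← Finset.smul_sum, hrel, smul_zero]
  have Fa := Module.Flat.lTensor_preserves_injective_linearMap (M := F) a a_inj
  have Fab := Module.Flat.lTensor_exact F ab
  let e : TensorProduct R F (Fin n → C) ≃ₗ[R] (Fin n → TensorProduct R F C) :=
    TensorProduct.piRight R R F (fun _ => C)
  let e' : TensorProduct R F (Fin m → C) ≃ₗ[R] (Fin m → TensorProduct R F C) :=
    TensorProduct.piRight R R F (fun _ => C)
  have he : ∀ x i, e ((a.lTensor F) (x ⊗ₜ (1 : R))) i = x ⊗ₜ p (Pi.single i 1) := by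
    intro x i
    simp [e, a]
  have heb : ∀ y j, e' (b.lTensor F y) j =
      ∑ i, (q (Pi.single j 1) : Fin n → R) i • e y i := by
    intro y j
    induction y with
    | zero => simp
    | tmul x d => simp [e, e', hb, TensorProduct.tmul_sum]
    | add y z hy hz => simp [hy, hz, Finset.sum_add_distrib]
  constructor
  · intro x y hxy
    refine (TensorProduct.rid R F).symm.injective (Fa (e.injective (funext fun i => ?_)))
    rw [TensorProduct.rid_symm_apply, TensorProduct.rid_symm_apply, he, he]
    exact LinearMap.congr_fun hxy _
  · intro h
    -- The values of `h` on the generators satisfy the relations of `C`, so they form a tuple killed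
    -- by `F ⊗ b` and come from `F`.
    have h0 : b.lTensor F (e.symm fun i => h (p (Pi.single i 1))) = 0 := by
      refine e'.injective (funext fun j => ?_)
      rw [heb, e.apply_symm_apply, map_zero e', Pi.zero_apply]
      simp_rw [← map_smul h]
      exact (map_sum h _ _).symm.trans (by rw [hrel, map_zero])
    obtain ⟨z, hz⟩ := (Fab _).1 h0
    refine ⟨TensorProduct.rid R F z, ext_gen _ _ _ fun i => ?_⟩
    rw [TensorProduct.mk_apply, ← he, ← TensorProduct.rid_symm_apply, LinearEquiv.symm_apply_apply,
      hz, e.apply_symm_apply]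

/-- The adjunction `- ⊗ C ⊣ Hom(C, -)`. -/
def tensorHomAdj (C : ModuleCat.{u} R) : tensorRight C ⊣ ihom C :=
  (ihom.adjunction C).ofNatIsoLeft (BraidedCategory.tensorLeftIsoTensorRight C)

theorem isIso_unit_of_flat [IsNoetherianRing R] {C : ModuleCat.{u} R} (hC : IsSemidualizing C)
    (F : ModuleCat.{u} R) [Module.Flat R F] : IsIso ((tensorHomAdj C).unit.app F) := by
  have := hC.finite
  have hbij := bijective_mk_of_flat F C hC.homothety_bijective
  rw [ConcreteCategory.isIso_iff_bijective]
  -- By definition the unit is `x ↦ (c ↦ x ⊗ c)`.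
  exact (ModuleCat.homEquiv (M := C) (N := F ⊗ C)).symm.bijective.comp hbij

/-- By the triangle identity, the counit at `F ⊗ C` is inverse to the unit at `F` tensored with `C`.
-/
theorem isIso_counit_of_cFlat [IsNoetherianRing R] {C : ModuleCat.{u} R} (hC : IsSemidualizing C)
    {X : ModuleCat.{u} R} (hX : cFlat C X) : IsIso ((tensorHomAdj C).counit.app X) := by
  obtain ⟨F, hF, ⟨e⟩⟩ := hX
  have := isIso_unit_of_flat hC F
  have h : IsIso ((tensorHomAdj C).counit.app ((tensorRight C).obj F)) := by
    have w := (tensorHomAdj C).left_triangle_components F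
    exact IsIso.of_isIso_fac_left w
  exact (NatTrans.isIso_app_iff_of_iso (tensorHomAdj C).counit e).2 h

theorem flat_ihom_of_cFlat [IsNoetherianRing R] {C : ModuleCat.{u} R} (hC : IsSemidualizing C)
    {X : ModuleCat.{u} R} (hX : cFlat C X) : Module.Flat R ((ihom C).obj X) := by
  obtain ⟨F, hF, ⟨e⟩⟩ := hX
  have := isIso_unit_of_flat hC F
  let i : F ≅ (ihom C).obj X := asIso ((tensorHomAdj C).unit.app F) ≪≫ (ihom C).mapIso e.symm
  exact Module.Flat.of_linearEquiv i.symm.toLinearEquiv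

theorem cProjective_tensor (C P : ModuleCat.{u} R) [Projective P] :
    cProjective C ((tensorRight C).obj P) :=
  ⟨P, (IsProjective.iff_projective _).2 inferInstance, ⟨Iso.refl _⟩⟩

theorem cProjective_self (C : ModuleCat.{u} R) : cProjective C C :=
  ⟨𝟙_ _, inferInstanceAs (Module.Projective R R), ⟨(λ_ C).symm⟩⟩

/-! ### Quasi-isomorphisms between complexes of flat modules -/

theorem tensorComplexMap_comm {K L : ChainComplex (ModuleCat.{u} R) ℕ} (f : K ⟶ L)
    {B B' : ModuleCat.{u} R} (g : B ⟶ B') :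
    ((tensorRight B).mapHomologicalComplex _).map f ≫ tensorComplexMap (𝟙 L) g =
      tensorComplexMap (𝟙 K) g ≫ ((tensorRight B').mapHomologicalComplex _).map f := by
  have h : ((tensorRight B').mapHomologicalComplex _).map f = tensorComplexMap f (𝟙 B') := by
    ext n : 1
    exact (MonoidalCategory.tensorHom_id _ _).symm
  rw [← tensorComplexMap_eq, h, ← tensorComplexMap_comp, Category.id_comp, Category.comp_id]

/-- The short complex `K ⊗ S` of complexes, for a short complex `S` of modules. -/
def tensorShortComplex (K : ChainComplex (ModuleCat.{u} R) ℕ)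
    (S : ShortComplex (ModuleCat.{u} R)) : ShortComplex (ChainComplex (ModuleCat.{u} R) ℕ) where
  X₁ := ((tensorRight S.X₁).mapHomologicalComplex _).obj K
  X₂ := ((tensorRight S.X₂).mapHomologicalComplex _).obj K
  X₃ := ((tensorRight S.X₃).mapHomologicalComplex _).obj K
  f := tensorComplexMap (𝟙 K) S.f
  g := tensorComplexMap (𝟙 K) S.g
  zero := by
    rw [← tensorComplexMap_comp, S.zero]
    ext n : 1
    exact MonoidalPreadditive.tensor_zero _

theorem tensorShortComplex_shortExact {K : ChainComplex (ModuleCat.{u} R) ℕ}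
    (hK : ∀ n, Module.Flat R (K.X n)) {S : ShortComplex (ModuleCat.{u} R)} (hS : S.ShortExact) :
    (tensorShortComplex K S).ShortExact := by
  refine HomologicalComplex.shortExact_of_degreewise_shortExact _ fun n => ?_
  have := hK n
  have h := hS.map_of_exact (tensorLeft (K.X n))
  refine ShortComplex.shortExact_of_iso (ShortComplex.isoMk (Iso.refl _) (Iso.refl _) (Iso.refl _)
    ?_ ?_) h
  · change 𝟙 _ ≫ (𝟙 (K.X n) ⊗ₘ S.f) = (K.X n ◁ S.f) ≫ 𝟙 _
    rw [id_tensorHom]; simp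
  · change 𝟙 _ ≫ (𝟙 (K.X n) ⊗ₘ S.g) = (K.X n ◁ S.g) ≫ 𝟙 _
    rw [id_tensorHom]; simp

/-- A quasi-isomorphism of complexes of flat modules remains one after tensoring. -/
theorem quasiIso_map_tensorRight_of_flat {K L : ChainComplex (ModuleCat.{u} R) ℕ} (f : K ⟶ L)
    [QuasiIso f] (hK : ∀ n, Module.Flat R (K.X n)) (hL : ∀ n, Module.Flat R (L.X n))
    (B : ModuleCat.{u} R) : QuasiIso (((tensorRight B).mapHomologicalComplex _).map f) := by
  -- Dimension shifting: the induction on the degree needs all `B` at once, since it passes from `B`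
  -- to the kernel of a projective cover map `Projective.π B`.
  suffices h : ∀ (n : ℕ) (B : ModuleCat.{u} R),
      IsIso (HomologicalComplex.homologyMap (((tensorRight B).mapHomologicalComplex _).map f) n) by
    rw [quasiIso_iff]
    intro n
    rw [quasiIsoAt_iff_isIso_homologyMap]
    exact h n B
  let S : ModuleCat.{u} R → ShortComplex (ModuleCat.{u} R) := fun B =>
    ShortComplex.mk (Limits.kernel.ι (Projective.π B)) (Projective.π B) (by simp)
  have hS : ∀ B, (S B).ShortExact := fun B =>
    { exact := ShortComplex.exact_kernel _
      mono_f := by dsimp [S]; infer_instance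
      epi_g := by dsimp [S]; infer_instance }
  let φ : ∀ B, tensorShortComplex K (S B) ⟶ tensorShortComplex L (S B) := fun B =>
    { τ₁ := ((tensorRight (S B).X₁).mapHomologicalComplex _).map f
      τ₂ := ((tensorRight (S B).X₂).mapHomologicalComplex _).map f
      τ₃ := ((tensorRight (S B).X₃).mapHomologicalComplex _).map f
      comm₁₂ := tensorComplexMap_comm f _
      comm₂₃ := tensorComplexMap_comm f _ }
  -- Tensoring with a projective module is exact, so the middle terms cause no trouble.
  have h₂ : ∀ B n, IsIso (HomologicalComplex.homologyMap (φ B).τ₂ n) := fun B n => by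
    have : Module.Projective R (Projective.over B : ModuleCat.{u} R) :=
      (IsProjective.iff_projective _).2 (Projective.projective_over B)
    have : QuasiIso (((tensorRight (Projective.over B)).mapHomologicalComplex _).map f) :=
      inferInstance
    change IsIso (HomologicalComplex.homologyMap
      (((tensorRight (Projective.over B)).mapHomologicalComplex _).map f) n)
    infer_instance
  intro n
  induction n with
  | zero =>
    have hepi : ∀ B : ModuleCat.{u} R, Epi (HomologicalComplex.homologyMap
        (((tensorRight B).mapHomologicalComplex _).map f) 0) := fun B =>
      HomologicalComplex.HomologySequence.epi_homologyMap_τ₃ (φ B)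
        (tensorShortComplex_shortExact hK (hS B)) (tensorShortComplex_shortExact hL (hS B)) 0
        inferInstance (by simp) (by simp)
    intro B
    exact HomologicalComplex.HomologySequence.isIso_homologyMap_τ₃ (φ B)
        (tensorShortComplex_shortExact hK (hS B)) (tensorShortComplex_shortExact hL (hS B)) 0
        (hepi _) inferInstance (by simp) (by simp)
  | succ n ih =>
    have h₁ : ∀ B j, (ComplexShape.down ℕ).Rel (n + 1) j →
        IsIso (HomologicalComplex.homologyMap (φ B).τ₁ j) := by
      intro B j hj
      obtain rfl : j = n := by simpa using hj
      exact ih _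
    -- The four lemma first gives surjectivity for every `B`. Surjectivity for the kernel term is
    -- then the input that the five lemma needs.
    have hepi : ∀ B : ModuleCat.{u} R, Epi (HomologicalComplex.homologyMap
        (((tensorRight B).mapHomologicalComplex _).map f) (n + 1)) := fun B =>
      HomologicalComplex.HomologySequence.epi_homologyMap_τ₃ (φ B)
        (tensorShortComplex_shortExact hK (hS B)) (tensorShortComplex_shortExact hL (hS B)) _
        inferInstance (fun j hj => have := h₁ B j hj; inferInstance) (fun _ _ => inferInstance)
    intro B
    exact HomologicalComplex.HomologySequence.isIso_homologyMap_τ₃ (φ B)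
        (tensorShortComplex_shortExact hK (hS B)) (tensorShortComplex_shortExact hL (hS B)) _
        (hepi _) inferInstance (h₁ B) (fun _ _ => inferInstance)

/-! ### The canonical proper resolution and its relative Tor -/

theorem tensorRight_map_eq_zero [IsNoetherianRing R] {C : ModuleCat.{u} R}
    (hC : IsSemidualizing C) {A F : ModuleCat.{u} R} [Module.Flat R F] (h : A ⟶ F)
    (w : (tensorRight C).map h = 0) : h = 0 := by
  have := isIso_unit_of_flat hC F
  have hm : Mono ((tensorHomAdj C).unit.app F) := IsIso.mono_of_iso _
  refine hm.right_cancellation h 0 ?_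
  rw [Limits.zero_comp]
  have n := (tensorHomAdj C).unit.naturality h
  rw [Functor.comp_map, w, (ihom C).map_zero, Limits.comp_zero] at n
  exact n

theorem tensorHomAdj_homEquiv_symm_zero (C A M : ModuleCat.{u} R) :
    ((tensorHomAdj C).homEquiv A M).symm 0 = 0 := by
  rw [Adjunction.homEquiv_counit, (tensorRight C).map_zero, Limits.zero_comp]

/-- Fullness of `- ⊗ C` on maps with flat target: transpose `g` to `A → Hom(C, F ⊗ C)` and invert
the unit at `F`. -/
theorem exists_tensorRight_map_eq [IsNoetherianRing R] {C : ModuleCat.{u} R}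
    (hC : IsSemidualizing C) {A F : ModuleCat.{u} R} [Module.Flat R F]
    (g : (tensorRight C).obj A ⟶ (tensorRight C).obj F) :
    ∃ h : A ⟶ F, (tensorRight C).map h = g := by
  have := isIso_unit_of_flat hC F
  refine ⟨(tensorHomAdj C).homEquiv _ _ g ≫ inv ((tensorHomAdj C).unit.app F), ?_⟩
  refine ((tensorHomAdj C).homEquiv _ _).injective ?_
  rw [(tensorHomAdj C).homEquiv_unit (f := (tensorRight C).map _), ← Functor.comp_map,
    ← (tensorHomAdj C).unit.naturality, Functor.id_map, Category.assoc]
  erw [IsIso.inv_hom_id, Category.comp_id]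

/-- The augmentation `P₀ ⟶ A` of a projective resolution of `A`. -/
def augmentation {A : ModuleCat.{u} R} (P : ProjectiveResolution A) : P.complex.X 0 ⟶ A :=
  P.π.f 0

instance {A : ModuleCat.{u} R} (P : ProjectiveResolution A) : Epi (augmentation P) :=
  inferInstanceAs (Epi (P.π.f 0))

theorem d_comp_augmentation {A : ModuleCat.{u} R} (P : ProjectiveResolution A) :
    P.complex.d 1 0 ≫ augmentation P = 0 :=
  P.complex_d_comp_π_f_zero

theorem exact_augmentation {A : ModuleCat.{u} R} (P : ProjectiveResolution A) :
    (ShortComplex.mk _ _ (d_comp_augmentation P)).Exact :=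
  P.exact₀

/-- `(P ⊗ C) ⊗ N ≅ P ⊗ (C ⊗ N)` for a complex `P`. -/
def tensorComplexAssoc (C N : ModuleCat.{u} R) (K : ChainComplex (ModuleCat.{u} R) ℕ) :
    ((tensorRight N).mapHomologicalComplex _).obj
      (((tensorRight C).mapHomologicalComplex _).obj K) ≅
      ((tensorRight (C ⊗ N)).mapHomologicalComplex _).obj K :=
  HomologicalComplex.Hom.isoOfComponents (fun n => α_ (K.X n) C N) fun i j _ => by
    exact (associator_naturality_left (K.d i j) C N).symm

theorem tensorComplexAssoc_naturality {C N N' : ModuleCat.{u} R}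
    {K K' : ChainComplex (ModuleCat.{u} R) ℕ} (φ : K ⟶ K') (g : N ⟶ N') :
    tensorComplexMap (((tensorRight C).mapHomologicalComplex _).map φ) g ≫
        (tensorComplexAssoc C N' K').hom =
      (tensorComplexAssoc C N K).hom ≫ tensorComplexMap φ (C ◁ g) := by
  ext n : 1
  change (φ.f n ▷ C ⊗ₘ g) ≫ (α_ (K'.X n) C N').hom =
    (α_ (K.X n) C N).hom ≫ (φ.f n ⊗ₘ C ◁ g)
  rw [← tensorHom_id, ← id_tensorHom, associator_naturality]

section

variable [IsNoetherianRing R] {C : ModuleCat.{u} R} (hC : IsSemidualizing C) {M : ModuleCat.{u} R}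

/-- Tensoring a projective resolution of `Hom(C, M)` with `C` gives a proper `P_C`-resolution
of `M`. -/
def tensorResolution (P : ProjectiveResolution ((ihom C).obj M)) :
    ProperResolution (cProjective C) M where
  complex := ((tensorRight C).mapHomologicalComplex _).obj P.complex
  mem n := cProjective_tensor C (P.complex.X n)
  π := ((tensorHomAdj C).homEquiv _ _).symm (augmentation P)
  d_comp_π := by
    change (tensorRight C).map (P.complex.d 1 0) ≫ _ = 0
    rw [← Adjunction.homEquiv_naturality_left_symm, d_comp_augmentation,
      tensorHomAdj_homEquiv_symm_zero]
  proper := by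
    -- For `Y ≅ A ⊗ C`, maps `Y → P_n ⊗ C` are maps `A → P_n`, and maps `Y → M` are maps `A → Hom(C,
    -- M)`. Exactness thus reduces to lifting from the projective `A` along the augmented
    -- resolution. Augmenting shifts degrees: `M` sits in degree 0 and `P_n ⊗ C` in degree `n + 1`.
    rintro Y ⟨A, hA, ⟨e⟩⟩
    have : Projective A := (IsProjective.iff_projective A).1 hA
    have hflat : ∀ n, Module.Flat R (P.complex.X n) := fun n =>
      have := (IsProjective.iff_projective _).2 (P.projective n)
      inferInstance
    intro n
    match n with
    | 0 =>
      rw [HomologicalComplex.exactAt_iff' _ 1 0 0 (by simp) (by simp),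
        ShortComplex.moduleCat_exact_iff]
      intro (g : Y ⟶ M) _
      let k : A ⟶ P.complex.X 0 :=
        Projective.factorThru ((tensorHomAdj C).homEquiv A M (e.inv ≫ g)) (augmentation P)
      refine ⟨e.hom ≫ (tensorRight C).map k, ?_⟩
      change (e.hom ≫ (tensorRight C).map k) ≫ ((tensorHomAdj C).homEquiv _ _).symm (augmentation P) = g
      rw [Category.assoc, ← Adjunction.homEquiv_naturality_left_symm]
      erw [Projective.factorThru_comp]
      simp
    | 1 =>
      rw [HomologicalComplex.exactAt_iff' _ 2 1 0 (by simp) (by simp),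
        ShortComplex.moduleCat_exact_iff]
      intro (g : Y ⟶ (tensorRight C).obj (P.complex.X 0)) hg
      replace hg : g ≫ ((tensorHomAdj C).homEquiv _ _).symm (augmentation P) = 0 := hg
      obtain ⟨h, hh⟩ := exists_tensorRight_map_eq hC (e.inv ≫ g)
      have w : h ≫ augmentation P = 0 := by
        refine ((tensorHomAdj C).homEquiv _ _).symm.injective ?_
        rw [Adjunction.homEquiv_naturality_left_symm]
        erw [hh]
        rw [Category.assoc]
        erw [hg]
        rw [Limits.comp_zero, tensorHomAdj_homEquiv_symm_zero]
      refine ⟨e.hom ≫ (tensorRight C).map ((exact_augmentation P).liftFromProjective h w), ?_⟩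
      change (e.hom ≫ (tensorRight C).map _) ≫ (tensorRight C).map (P.complex.d 1 0) = g
      rw [Category.assoc, ← Functor.map_comp]
      erw [(exact_augmentation P).liftFromProjective_comp h w, hh]
      simp
    | n + 2 =>
      rw [HomologicalComplex.exactAt_iff' _ (n + 3) (n + 2) (n + 1) (by simp) (by simp),
        ShortComplex.moduleCat_exact_iff]
      intro (g : Y ⟶ (tensorRight C).obj (P.complex.X (n + 1))) hg
      replace hg : g ≫ (tensorRight C).map (P.complex.d (n + 1) n) = 0 := hg
      obtain ⟨h, hh⟩ := exists_tensorRight_map_eq hC (e.inv ≫ g)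
      have w : h ≫ P.complex.d (n + 1) n = 0 := by
        refine tensorRight_map_eq_zero hC _ ?_
        rw [Functor.map_comp, hh, Category.assoc, hg, Limits.comp_zero]
      refine ⟨e.hom ≫ (tensorRight C).map ((P.exact_succ n).liftFromProjective h w), ?_⟩
      change (e.hom ≫ (tensorRight C).map _) ≫ (tensorRight C).map (P.complex.d (n + 2) (n + 1)) = g
      rw [Category.assoc, ← Functor.map_comp]
      erw [(P.exact_succ n).liftFromProjective_comp h w, hh]
      simp

theorem isLift_tensorResolution {M' : ModuleCat.{u} R} (P : ProjectiveResolution ((ihom C).obj M))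
    (P' : ProjectiveResolution ((ihom C).obj M')) (f : M ⟶ M') (φ : P.complex ⟶ P'.complex)
    (hφ : φ.f 0 ≫ augmentation P' = augmentation P ≫ (ihom C).map f) :
    ProperResolution.IsLift (tensorResolution hC P) (tensorResolution hC P') f
      (((tensorRight C).mapHomologicalComplex _).map φ) := by
  change (tensorRight C).map (φ.f 0) ≫ ((tensorHomAdj C).homEquiv _ _).symm (augmentation P') =
    ((tensorHomAdj C).homEquiv _ _).symm (augmentation P) ≫ f
  rw [← Adjunction.homEquiv_naturality_left_symm, ← Adjunction.homEquiv_naturality_right_symm]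
  exact congrArg _ hφ

/-- The relative Tor module of a canonical resolution is `Tor_i(Hom(C, M), C ⊗ N)`. -/
def relTorTensorResolutionIso (P : ProjectiveResolution ((ihom C).obj M)) (N : ModuleCat.{u} R)
    (i : ℕ) : relTor (tensorResolution hC P) N i ≅ torHomTensor C M N i :=
  (HomologicalComplex.homologyFunctor _ _ i).mapIso (tensorComplexAssoc C N P.complex) ≪≫
    (P.isoLeftDerivedObj (tensorRight (C ⊗ N)) i).symm

theorem relTorTensorResolutionIso_naturality {M' N N' : ModuleCat.{u} R}
    (P : ProjectiveResolution ((ihom C).obj M)) (P' : ProjectiveResolution ((ihom C).obj M'))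
    (f : M ⟶ M') (g : N ⟶ N') (i : ℕ) :
    relTorMap le_rfl (tensorResolution hC P) (tensorResolution hC P') f g i ≫
        (relTorTensorResolutionIso hC P' N' i).hom =
      (relTorTensorResolutionIso hC P N i).hom ≫ torHomTensorMap C f g i := by
  let φ := ProjectiveResolution.lift ((ihom C).map f) P P'
  have hφ : φ.f 0 ≫ augmentation P' = augmentation P ≫ (ihom C).map f :=
    ProjectiveResolution.lift_commutes_zero _ _ _
  rw [relTorMap_eq le_rfl _ _ f g i _ (isLift_tensorResolution hC P P' f φ hφ)]
  have hM := P.isoLeftDerivedObj_inv_naturality ((ihom C).map f) P' φ hφ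
    (tensorRight (C ⊗ N)) i
  have hN := P'.leftDerived_app_eq ((tensoringRight (ModuleCat.{u} R)).map (C ◁ g)) i
  -- The splitting follows `torHomTensorMap`: first the variable `M`, handled by `hM`, then `N`,
  -- handled by `hN`.
  have e : tensorComplexMap φ (C ◁ g) = ((tensorRight (C ⊗ N)).mapHomologicalComplex _).map φ ≫
      (NatTrans.mapHomologicalComplex ((tensoringRight (ModuleCat.{u} R)).map (C ◁ g)) _).app
        P'.complex := by
    ext n : 1
    exact tensorHom_def _ _
  have key : HomologicalComplex.homologyMap
        (tensorComplexMap (((tensorRight C).mapHomologicalComplex _).map φ) g) i ≫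
        HomologicalComplex.homologyMap (tensorComplexAssoc C N' P'.complex).hom i =
      HomologicalComplex.homologyMap (tensorComplexAssoc C N P.complex).hom i ≫
        HomologicalComplex.homologyMap (((tensorRight (C ⊗ N)).mapHomologicalComplex _).map φ) i ≫
        HomologicalComplex.homologyMap ((NatTrans.mapHomologicalComplex
          ((tensoringRight (ModuleCat.{u} R)).map (C ◁ g)) _).app P'.complex) i := by
    simp only [← HomologicalComplex.homologyMap_comp]
    rw [tensorComplexAssoc_naturality, e]
  refine (reassoc_of% key) (P'.isoLeftDerivedObj (tensorRight (C ⊗ N')) i).inv |>.trans ?_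
  refine Eq.trans ?_ (Category.assoc _ _ _).symm
  refine congrArg (fun t => HomologicalComplex.homologyMap
    (tensorComplexAssoc C N P.complex).hom i ≫ t) ?_
  refine Eq.trans ?_ (congrArg (fun t => _ ≫ _ ≫ t) hN.symm)
  refine Eq.trans ?_ (((Category.assoc _ _ _).symm.trans (hM =≫ _)).trans
    (Category.assoc _ _ _)).symm
  refine congrArg (fun t => HomologicalComplex.homologyMap
    (((tensorRight (C ⊗ N)).mapHomologicalComplex _).map φ) i ≫ t) ?_
  exact (Iso.inv_hom_id_assoc (P'.isoLeftDerivedObj (tensorRight (C ⊗ N)) i) _).symm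

end

/-! ### Comparison of proper resolutions -/

/-- The augmentation of an acyclic augmented complex is a quasi-isomorphism. -/
theorem quasiIso_toSingle₀_of_acyclic_augment (K : ChainComplex (ModuleCat.{u} R) ℕ)
    {A : ModuleCat.{u} R} (ε : K.X 0 ⟶ A) (w : K.d 1 0 ≫ ε = 0)
    (h₀ : Function.Surjective ε) (h₁ : (ShortComplex.mk _ _ w).Exact)
    (h₂ : ∀ n, K.ExactAt (n + 1)) :
    QuasiIso ((ChainComplex.toSingle₀Equiv K A).symm ⟨ε, w⟩) := by
  refine ⟨fun n => ?_⟩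
  cases n with
  | zero =>
    rw [ChainComplex.quasiIsoAt₀_iff, ShortComplex.quasiIso_iff_of_zeros' _ (K.shape _ _ (by simp)) rfl rfl]
    have hε : Epi ε := (ModuleCat.epi_iff_surjective ε).2 h₀
    refine (ShortComplex.exact_and_epi_g_iff_of_iso ?_).2 ⟨h₁, hε⟩
    refine ShortComplex.isoMk (Iso.refl _) (Iso.refl _) (Iso.refl _) ?_ ?_
    · exact (Category.id_comp _).trans (Category.comp_id _).symm
    · exact (Category.id_comp _).trans (Category.comp_id _).symm
  | succ n =>
    rw [quasiIsoAt_iff_exactAt' (hL := ChainComplex.exactAt_succ_single_obj ..)]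
    exact h₂ n

section

variable {X X' : ObjectProperty (ModuleCat.{u} R)} {M : ModuleCat.{u} R}

/-- The augmentation `Hom(Y, G) ⟶ Hom(Y, M)`. -/
def homAugmentation (Y : ModuleCat.{u} R) (G : ProperResolution X M) :
    ((ihom Y).mapHomologicalComplex _).obj G.complex ⟶
      (ChainComplex.single₀ (ModuleCat.{u} R)).obj ((ihom Y).obj M) :=
  (ChainComplex.toSingle₀Equiv _ _).symm ⟨(ihom Y).map G.π, by
    change (ihom Y).map _ ≫ (ihom Y).map _ = 0
    rw [← Functor.map_comp, G.d_comp_π, Functor.map_zero]⟩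

theorem homAugmentation_f_zero (Y : ModuleCat.{u} R) (G : ProperResolution X M) :
    (homAugmentation Y G).f 0 = (ihom Y).map G.π :=
  ChainComplex.toSingle₀Equiv_symm_apply_f_zero _ _

theorem quasiIso_homAugmentation {Y : ModuleCat.{u} R} (hY : X Y) (G : ProperResolution X M) :
    QuasiIso (homAugmentation Y G) := by
  refine quasiIso_toSingle₀_of_acyclic_augment _ _ _ ?_ ?_ ?_
  · exact fun g => G.lift_zero hY g
  · rw [ShortComplex.moduleCat_exact_iff]
    exact fun g hg => G.lift_one hY g hg
  · intro n
    rw [HomologicalComplex.exactAt_iff' _ (n + 2) (n + 1) n (by simp) (by simp),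
      ShortComplex.moduleCat_exact_iff]
    exact fun g hg => G.lift_succ hY n g hg

/-- Two out of three: `Hom(Y, Q)` and `Hom(Y, G)` both resolve `Hom(Y, M)`, compatibly with `φ`. -/
theorem quasiIso_hom_of_isLift (h : X ≤ X') {Y : ModuleCat.{u} R} (hY : X Y)
    (Q : ProperResolution X M) (G : ProperResolution X' M) (φ : Q.complex ⟶ G.complex)
    (hφ : ProperResolution.IsLift Q G (𝟙 M) φ) :
    QuasiIso (((ihom Y).mapHomologicalComplex _).map φ) := by
  have := quasiIso_homAugmentation hY Q
  have := quasiIso_homAugmentation (h _ hY) G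
  have w : ((ihom Y).mapHomologicalComplex _).map φ ≫ homAugmentation Y G =
      homAugmentation Y Q := by
    apply (ChainComplex.toSingle₀Equiv _ _).injective
    ext1
    change (ihom Y).map (φ.f 0) ≫ (homAugmentation Y G).f 0 = (homAugmentation Y Q).f 0
    rw [homAugmentation_f_zero, homAugmentation_f_zero]
    exact ((ihom Y).map_comp _ _).symm.trans (congrArg _ (hφ.trans (Category.comp_id _)))
  have : QuasiIso (((ihom Y).mapHomologicalComplex _).map φ ≫ homAugmentation Y G) := by
    rwa [w]
  exact quasiIso_of_comp_right _ (homAugmentation Y G)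

end

section

variable [IsNoetherianRing R] {C : ModuleCat.{u} R}

/-- The evaluation isomorphism `Hom(C, K) ⊗ C ≅ K` for a complex `K` of `C`-flat modules. -/
def evalComplexIso (hC : IsSemidualizing C) (K : ChainComplex (ModuleCat.{u} R) ℕ) (hK : ∀ n, cFlat C (K.X n)) :
    ((tensorRight C).mapHomologicalComplex _).obj (((ihom C).mapHomologicalComplex _).obj K) ≅ K :=
  HomologicalComplex.Hom.isoOfComponents
    (fun n =>
      @asIso _ _ _ _ ((tensorHomAdj C).counit.app (K.X n)) (isIso_counit_of_cFlat hC (hK n)))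
    fun i j _ => ((tensorHomAdj C).counit.naturality (K.d i j)).symm

theorem quasiIso_tensor_of_quasiIso_hom (hC : IsSemidualizing C) {K L : ChainComplex (ModuleCat.{u} R) ℕ}
    (hK : ∀ n, cFlat C (K.X n)) (hL : ∀ n, cFlat C (L.X n)) (φ : K ⟶ L)
    [QuasiIso (((ihom C).mapHomologicalComplex _).map φ)] (N : ModuleCat.{u} R) :
    QuasiIso (((tensorRight N).mapHomologicalComplex _).map φ) := by
  have h := quasiIso_map_tensorRight_of_flat (((ihom C).mapHomologicalComplex _).map φ)
    (fun n => flat_ihom_of_cFlat hC (hK n)) (fun n => flat_ihom_of_cFlat hC (hL n)) (C ⊗ N)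
  refine (quasiIso_iff_of_arrow_mk_iso _ _ (Arrow.isoMk
    ((tensorComplexAssoc C N _).symm ≪≫
      ((tensorRight N).mapHomologicalComplex _).mapIso (evalComplexIso hC K hK))
    ((tensorComplexAssoc C N _).symm ≪≫
      ((tensorRight N).mapHomologicalComplex _).mapIso (evalComplexIso hC L hL)) ?_)).1 h
  ext n : 1
  change ((α_ _ C N).inv ≫ ((tensorHomAdj C).counit.app (K.X n)) ▷ N) ≫ φ.f n ▷ N =
    (ihom C).map (φ.f n) ▷ (C ⊗ N) ≫ (α_ _ C N).inv ≫ ((tensorHomAdj C).counit.app (L.X n)) ▷ N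
  rw [associator_inv_naturality_left_assoc, Category.assoc, ← comp_whiskerRight,
    ← comp_whiskerRight]
  exact congrArg (fun t => _ ≫ t ▷ N) ((tensorHomAdj C).counit.naturality (φ.f n)).symm

/-- Leaving the classes general covers both a change of `P_C`-resolution and the comparison map
`rho`. -/
theorem isIso_relTorMap_id (hC : IsSemidualizing C) {X X' : ObjectProperty (ModuleCat.{u} R)} (h : X ≤ X')
    (hX : X C) (hX' : X' ≤ cFlat C) {M : ModuleCat.{u} R} (Q : ProperResolution X M)
    (G : ProperResolution X' M) (N : ModuleCat.{u} R) (i : ℕ) :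
    IsIso (relTorMap h Q G (𝟙 M) (𝟙 N) i) := by
  obtain ⟨φ, hφ⟩ := ProperResolution.exists_isLift h Q G (𝟙 M)
  have := quasiIso_hom_of_isLift h hX Q G φ hφ
  have := quasiIso_tensor_of_quasiIso_hom hC (fun n => hX' _ (h _ (Q.mem n)))
    (fun n => hX' _ (G.mem n)) φ N
  rw [relTorMap_eq h Q G (𝟙 M) (𝟙 N) i φ hφ, tensorComplexMap_eq, tensorComplexMap_id,
    Category.comp_id]
  exact (quasiIsoAt_iff_isIso_homologyMap _ _).1 (this.quasiIsoAt i)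

end

end RelativeTor

end

theorem theorem2 {R : Type u} [CommRing R] [IsNoetherianRing R]
    (C : ModuleCat.{u} R) (hC : RelativeTor.IsSemidualizing C) (i : ℕ) :
    (∃ α : ∀ (M N : ModuleCat.{u} R)
        (Q : RelativeTor.ProperResolution (RelativeTor.cProjective C) M),
        RelativeTor.relTor Q N i ≅ RelativeTor.torHomTensor C M N i,
      ∀ (M M' N N' : ModuleCat.{u} R)
        (Q : RelativeTor.ProperResolution (RelativeTor.cProjective C) M)
        (Q' : RelativeTor.ProperResolution (RelativeTor.cProjective C) M')
        (f : M ⟶ M') (g : N ⟶ N'),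
        RelativeTor.relTorMap le_rfl Q Q' f g i ≫ (α M' N' Q').hom =
          (α M N Q).hom ≫ RelativeTor.torHomTensorMap C f g i) ∧
    (∃ β : ∀ (M N : ModuleCat.{u} R)
        (G : RelativeTor.ProperResolution (RelativeTor.cFlat C) M),
        RelativeTor.torHomTensor C M N i ≅ RelativeTor.relTor G N i,
      ∀ (M M' N N' : ModuleCat.{u} R)
        (G : RelativeTor.ProperResolution (RelativeTor.cFlat C) M)
        (G' : RelativeTor.ProperResolution (RelativeTor.cFlat C) M')
        (f : M ⟶ M') (g : N ⟶ N'),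
        RelativeTor.torHomTensorMap C f g i ≫ (β M' N' G').hom =
          (β M N G).hom ≫ RelativeTor.relTorMap le_rfl G G' f g i) ∧
    (∀ (M N : ModuleCat.{u} R)
      (Q : RelativeTor.ProperResolution (RelativeTor.cProjective C) M)
      (G : RelativeTor.ProperResolution (RelativeTor.cFlat C) M),
      IsIso (RelativeTor.rho C Q G N i)) := by
  open RelativeTor in
  let Q₀ (M : ModuleCat.{u} R) := tensorResolution hC (projectiveResolution ((ihom C).obj M))
  let t (M N : ModuleCat.{u} R) : relTor (Q₀ M) N i ≅ torHomTensor C M N i :=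
    relTorTensorResolutionIso hC (projectiveResolution ((ihom C).obj M)) N i
  have ht {M M' N N' : ModuleCat.{u} R} (f : M ⟶ M') (g : N ⟶ N') :
      relTorMap le_rfl (Q₀ M) (Q₀ M') f g i ≫ (t M' N').hom =
        (t M N).hom ≫ torHomTensorMap C f g i :=
    relTorTensorResolutionIso_naturality hC _ _ f g i
  have hα {M : ModuleCat.{u} R} (N : ModuleCat.{u} R) (Q : ProperResolution (cProjective C) M) :
      IsIso (relTorMap le_rfl Q (Q₀ M) (𝟙 M) (𝟙 N) i) :=
    isIso_relTorMap_id hC le_rfl (cProjective_self C) (cProjective_le_cFlat C) Q (Q₀ M) N i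
  have hρ {M : ModuleCat.{u} R} (N : ModuleCat.{u} R) (Q : ProperResolution (cProjective C) M)
      (G : ProperResolution (cFlat C) M) : IsIso (rho C Q G N i) :=
    isIso_relTorMap_id hC (cProjective_le_cFlat C) (cProjective_self C) le_rfl Q G N i
  -- Both isomorphisms pass through the canonical resolution `Q₀ M`, whose relative Tor is the
  -- absolute Tor by `t`.
  refine ⟨⟨fun M N Q => asIso (relTorMap le_rfl Q (Q₀ M) (𝟙 M) (𝟙 N) i) ≪≫ t M N, ?_⟩,
    ⟨fun M N G => (t M N).symm ≪≫ asIso (rho C (Q₀ M) G N i), ?_⟩, fun M N Q G => hρ N Q G⟩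
  · intro M M' N N' Q Q' f g
    simp only [Iso.trans_hom, asIso_hom, Category.assoc, ← ht]
    simp only [← Category.assoc, relTorMap_comp, Category.id_comp, Category.comp_id]
  · intro M M' N N' G G' f g
    simp only [Iso.trans_hom, Iso.symm_hom, asIso_hom, Category.assoc]
    rw [Iso.eq_inv_comp, ← reassoc_of% (ht f g), Iso.hom_inv_id_assoc]
    exact rho_naturality C (Q₀ M) G (Q₀ M') G' f g i
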